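/- Let $\mathfrak g$ be a finite-dimensional complex simple Lie algebra with Killing form $B$ and adjoint group $G$, and let $p_1,\dots,p_r$ be homogeneous, algebraically independent generators, of respective degrees $m_1+1,\dots,m_r+1$, of the algebra $\mathbb C[\mathfrak g]^G$ of $G$-invariant polynomial functions on $\mathfrak g$. Let $P_j:\mathfrak g\to\mathfrak g$ be the gradient of $p_j$ with respect to $B$, that is, $dp_j(x)(y)=B(P_j(x),y)$ for all $x,y\in\mathfrak g$. Let $e\in\mathfrak g$ be nilpotent and let $h,f\in\mathfrak g$ satisfy $[h,e]=2e$, $[h,f]=-2f$, $[e,f]=h$. Let $z=\{x\in\mathfrak g:[e,x]=0\}$ be the centralizer of $e$, $\delta$ the centre of $z$, and $\eta$ the normalizer of $z$ in $\mathfrak g$. Assume that $\delta$ is spanned by $P_1(e),\dots,P_r(e)$. Choose indices $j_1,\dots,j_s$ such that $(P_{j_1}(e),\dots,P_{j_s}(e))$ is a basis of $\delta$, and put $Q_i=P_{j_i}$, $m'_i=m_{j_i}$ and $$y_i=dQ_i(e).h=\frac{d}{dt}\Big|_{t=0}Q_i(e+th)\qquad(1\le i\le s).$$ Then $$\eta=z\oplus\bigoplus_{i=1}^s\mathbb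 C\,y_i ,$$ that is, $y_1,\dots,y_s$ are linearly independent and $\eta$ is the direct sum of $z$ and of their span. Moreover $[e,y_i]=-2m'_i\,Q_i(e)$ for $1\le i\le s$, and $\operatorname{ad}e$ maps $\operatorname{span}\{y_1,\dots,y_s\}$ bijectively onto $\delta$. -/

import Mathlib

open Module

noncomputable section

namespace NilpotentNormalizer

section Calculus

variable {V W : Type*} [AddCommGroup V] [Module ℂ V] [FiniteDimensional ℂ V]
  [AddCommGroup W] [Module ℂ W] [FiniteDimensional ℂ W]

/-- The exponential of an endomorphism of a finite-dimensional complex vector space, i.e. the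
endomorphism whose matrix (in any basis) is the exponential of the matrix of `φ`. -/
def endExp (φ : V →ₗ[ℂ] V) : V →ₗ[ℂ] V :=
  Matrix.toLin (finBasis ℂ V) (finBasis ℂ V)
    (NormedSpace.exp (LinearMap.toMatrix (finBasis ℂ V) (finBasis ℂ V) φ))

variable (V) in
/-- The algebra `ℂ[V]` of polynomial functions on `V`: the algebra of functions generated by
the linear forms. -/
def polynomialFunctions : Subalgebra ℂ (V → ℂ) :=
  Algebra.adjoin ℂ {u : V → ℂ | ∃ l : Dual ℂ V, u = fun x => l x}

/-- The differential `dp(x)`, a linear form on `V`, of a (polynomial) function `p : V → ℂ`; it is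
the linear form taking at each basis vector the value of the corresponding partial derivative. -/
def differential (p : V → ℂ) (x : V) : Dual ℂ V :=
  (finBasis ℂ V).constr ℂ fun i => deriv (fun t : ℂ => p (x + t • finBasis ℂ V i)) 0

/-- The derivative `dF(x).v = (d/dt)₀ F(x + t v)` of a (polynomial) map `F : V → W`, computed
coordinatewise in a basis of `W`. -/
def dirDeriv (F : V → W) (x v : V) : W :=
  ∑ i, deriv (fun t : ℂ => (finBasis ℂ W).repr (F (x + t • v)) i) 0 • finBasis ℂ W i

theorem hasDerivAt_differential {p : V → ℂ} (hp : p ∈ polynomialFunctions V) (x v : V) :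
    HasDerivAt (fun t : ℂ => p (x + t • v)) (differential p x v) 0 := by
  have key : ∃ L : Dual ℂ V, ∀ v, HasDerivAt (fun t : ℂ => p (x + t • v)) (L v) 0 := by
    induction hp using Algebra.adjoin_induction with
    | mem u hu =>
      obtain ⟨l, rfl⟩ := hu
      refine ⟨l, fun v => ?_⟩
      simpa using ((hasDerivAt_id (0 : ℂ)).mul_const (l v)).const_add (l x)
    | algebraMap c => exact ⟨0, fun v => by simpa using hasDerivAt_const (0 : ℂ) c⟩
    | add a b _ _ ha hb =>
      obtain ⟨A, hA⟩ := ha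
      obtain ⟨B, hB⟩ := hb
      exact ⟨A + B, fun v => (hA v).add (hB v)⟩
    | mul a b _ _ ha hb =>
      obtain ⟨A, hA⟩ := ha
      obtain ⟨B, hB⟩ := hb
      refine ⟨b x • A + a x • B, fun v => ?_⟩
      have hAB := (hA v).mul (hB v)
      simp only [zero_smul, add_zero] at hAB
      have hv : (b x • A + a x • B) v = A v * b x + a x * B v := by
        simp only [LinearMap.add_apply, LinearMap.smul_apply, smul_eq_mul]
        ring
      rw [hv]
      exact hAB
  obtain ⟨L, hL⟩ := key
  have : differential p x = L :=
    (finBasis ℂ V).ext fun i => by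
      rw [differential, Basis.constr_basis]
      exact (hL _).deriv
  rw [this]
  exact hL v

end Calculus

section LieAlgebra

variable (𝔤 : Type*) [LieRing 𝔤] [LieAlgebra ℂ 𝔤] [FiniteDimensional ℂ 𝔤]

/-- The adjoint group of `𝔤`: the group of linear automorphisms of `𝔤` generated by the
`exp (ad x)`, for `x` in `𝔤`. -/
def adjointGroup : Subgroup (𝔤 ≃ₗ[ℂ] 𝔤) :=
  Subgroup.closure {φ | ∃ x : 𝔤, (φ : 𝔤 →ₗ[ℂ] 𝔤) = endExp (LieAlgebra.ad ℂ 𝔤 x)}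

/-- The algebra `ℂ[𝔤]^G` of polynomial functions on `𝔤` invariant under the adjoint group `G`. -/
def invariants : Subalgebra ℂ (𝔤 → ℂ) where
  carrier := {u | u ∈ polynomialFunctions 𝔤 ∧ ∀ φ ∈ adjointGroup 𝔤, ∀ x, u (φ x) = u x}
  mul_mem' ha hb := ⟨mul_mem ha.1 hb.1, fun φ hφ x => by simp [ha.2 φ hφ x, hb.2 φ hφ x]⟩
  add_mem' ha hb := ⟨add_mem ha.1 hb.1, fun φ hφ x => by simp [ha.2 φ hφ x, hb.2 φ hφ x]⟩
  algebraMap_mem' c := ⟨Subalgebra.algebraMap_mem _ c, fun _ _ _ => rfl⟩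

/-- `p₁, …, p_r` are homogeneous algebraically independent generators, of respective degrees
`m₁ + 1, …, m_r + 1`, of the algebra of invariant polynomial functions on `𝔤`. -/
structure IsBasicInvariants {r : ℕ} (p : Fin r → 𝔤 → ℂ) (m : Fin r → ℕ) : Prop where
  homogeneous : ∀ (j : Fin r) (c : ℂ) (x : 𝔤), p j (c • x) = c ^ (m j + 1) * p j x
  algebraicIndependent : AlgebraicIndependent ℂ p
  adjoin_eq : Algebra.adjoin ℂ (Set.range p) = invariants 𝔤

variable {𝔤}

/-- The gradient of `p` with respect to the (nondegenerate) Killing form `B`: the vector field `P`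
such that `B (P x) y = dp(x) y` for all `y`. -/
def killingGradient [LieAlgebra.IsKilling ℂ 𝔤] (p : 𝔤 → ℂ) (x : 𝔤) : 𝔤 :=
  (LinearMap.BilinForm.toDual (killingForm ℂ 𝔤)
    (LieAlgebra.IsKilling.killingForm_nondegenerate ℂ 𝔤)).symm (differential p x)

theorem killingForm_killingGradient [LieAlgebra.IsKilling ℂ 𝔤] (p : 𝔤 → ℂ) (x y : 𝔤) :
    killingForm ℂ 𝔤 (killingGradient p x) y = differential p x y := by
  rw [killingGradient, LinearMap.BilinForm.apply_toDual_symm_apply]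

/-- The centralizer `z(e)` of an element `e` of `𝔤`. -/
def centralizer (e : 𝔤) : LieSubalgebra ℂ 𝔤 where
  carrier := {x | ⁅e, x⁆ = 0}
  add_mem' ha hb := by simp_all
  zero_mem' := by simp
  smul_mem' c x hx := by simp_all
  lie_mem' {x y} hx hy := by simp_all [leibniz_lie e x y]

/-- The centre `δ(e)` of the centralizer of `e`, as a subspace of `𝔤`. -/
def centralizerCenter (e : 𝔤) : Submodule ℂ 𝔤 :=
  (LieAlgebra.center ℂ (centralizer e)).toSubmodule.map (centralizer e).toSubmodule.subtype

end LieAlgebra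

end NilpotentNormalizer

end

open Topology

namespace NilpotentNormalizer

/-! ### Differential calculus of polynomial functions. -/

section PolynomialCalculus

/-! An element `x` normalizes `z` exactly when `[e, x]` lies in `δ` (`mem_normalizer_centralizer`),
so `η` is the preimage of `δ` under `ad e`, whose kernel is `z`. It remains to find preimages of a
basis of `δ`.

For the gradient `P` of an invariant of degree `m + 1`, infinitesimal equivariance reads `dP(x).[a,
x] = [a, P(x)]`, and symmetry of the Hessian turns it into `[x, dP(x).v] = -[v, P(x)]`. With Euler's
identity, `[e, dP(e).h] = -[h, P(e)] = -dP(e).[h, e] = -2 dP(e).e = -2m P(e)`. Here `m ≠ 0` whenever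
`P(e) ≠ 0`, since an invariant of degree one has zero gradient. Hence `ad e` sends the `y_i` to
nonzero multiples of a basis of `δ`, and `normalizer_eq_of_lie_basis` concludes. -/

/-- Derivatives are tested on linear forms, so that `W` needs no norm. -/
theorem dirDeriv_eq {V W : Type*} [AddCommGroup V] [Module ℂ V]
    [AddCommGroup W] [Module ℂ W] [FiniteDimensional ℂ W] {F : V → W} {x v : V} {w : W}
    (h : ∀ l : Dual ℂ W, HasDerivAt (fun t : ℂ => l (F (x + t • v))) (l w) 0) :
    dirDeriv F x v = w := by
  rw [dirDeriv]
  conv_rhs => rw [← (finBasis ℂ W).sum_repr w]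
  exact Finset.sum_congr rfl fun i _ => by
    rw [← Basis.coord_apply, ← (h ((finBasis ℂ W).coord i)).deriv]
    rfl

variable {V : Type*} [AddCommGroup V] [Module ℂ V] [FiniteDimensional ℂ V]

theorem differential_apply_eq {p : V → ℂ} (hp : p ∈ polynomialFunctions V) {x v : V} {c : ℂ}
    (h : HasDerivAt (fun t : ℂ => p (x + t • v)) c 0) : differential p x v = c :=
  (hasDerivAt_differential hp x v).unique h

theorem differential_linear (l : Dual ℂ V) (x v : V) : differential (fun x => l x) x v = l v := by
  refine differential_apply_eq (Algebra.subset_adjoin ⟨l, rfl⟩) ?_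
  simpa using ((hasDerivAt_id (0 : ℂ)).mul_const (l v)).const_add (l x)

theorem differential_algebraMap (c : ℂ) (x v : V) :
    differential (algebraMap ℂ (V → ℂ) c) x v = 0 :=
  differential_apply_eq (Subalgebra.algebraMap_mem _ c) (by simpa using hasDerivAt_const (0 : ℂ) c)

theorem differential_add {a b : V → ℂ} (ha : a ∈ polynomialFunctions V)
    (hb : b ∈ polynomialFunctions V) (x v : V) :
    differential (a + b) x v = differential a x v + differential b x v :=
  differential_apply_eq (add_mem ha hb)
    ((hasDerivAt_differential ha x v).add (hasDerivAt_differential hb x v))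

theorem differential_mul {a b : V → ℂ} (ha : a ∈ polynomialFunctions V)
    (hb : b ∈ polynomialFunctions V) (x v : V) :
    differential (a * b) x v = differential a x v * b x + a x * differential b x v :=
  differential_apply_eq (mul_mem ha hb) (by
    have := (hasDerivAt_differential ha x v).mul (hasDerivAt_differential hb x v)
    simp only [zero_smul, add_zero] at this
    exact this)

/-- The derivative of a function in a fixed direction, as a function of the point. -/
noncomputable def partialDeriv (v : V) (p : V → ℂ) : V → ℂ := fun x => differential p x v

theorem partialDeriv_linear (l : Dual ℂ V) (v : V) :
    partialDeriv v (fun x => l x) = algebraMap ℂ (V → ℂ) (l v) :=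
  funext fun x => differential_linear l x v

theorem partialDeriv_algebraMap (c : ℂ) (v : V) :
    partialDeriv v (algebraMap ℂ (V → ℂ) c) = algebraMap ℂ (V → ℂ) 0 :=
  funext fun x => differential_algebraMap c x v

theorem partialDeriv_add {a b : V → ℂ} (ha : a ∈ polynomialFunctions V)
    (hb : b ∈ polynomialFunctions V) (v : V) :
    partialDeriv v (a + b) = partialDeriv v a + partialDeriv v b :=
  funext fun x => differential_add ha hb x v

theorem partialDeriv_mul {a b : V → ℂ} (ha : a ∈ polynomialFunctions V)
    (hb : b ∈ polynomialFunctions V) (v : V) :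
    partialDeriv v (a * b) = partialDeriv v a * b + a * partialDeriv v b :=
  funext fun x => differential_mul ha hb x v

theorem partialDeriv_mem {p : V → ℂ} (hp : p ∈ polynomialFunctions V) (v : V) :
    partialDeriv v p ∈ polynomialFunctions V := by
  induction hp using Algebra.adjoin_induction with
  | mem u hu =>
    obtain ⟨l, rfl⟩ := hu
    rw [partialDeriv_linear]
    exact Subalgebra.algebraMap_mem _ _
  | algebraMap c =>
    rw [partialDeriv_algebraMap]
    exact Subalgebra.algebraMap_mem _ _
  | add a b ha hb iha ihb =>
    rw [partialDeriv_add ha hb]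
    exact add_mem iha ihb
  | mul a b ha hb iha ihb =>
    rw [partialDeriv_mul ha hb]
    exact add_mem (mul_mem iha hb) (mul_mem ha ihb)

/-- The Leibniz rule reduces the symmetry to linear forms and constants, whose second derivatives
vanish. -/
theorem partialDeriv_comm {p : V → ℂ} (hp : p ∈ polynomialFunctions V) (v w : V) :
    partialDeriv v (partialDeriv w p) = partialDeriv w (partialDeriv v p) := by
  induction hp using Algebra.adjoin_induction with
  | mem u hu =>
    obtain ⟨l, rfl⟩ := hu
    simp only [partialDeriv_linear, partialDeriv_algebraMap]
  | algebraMap c => simp only [partialDeriv_algebraMap]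
  | add a b ha hb iha ihb =>
    rw [partialDeriv_add ha hb, partialDeriv_add ha hb,
      partialDeriv_add (partialDeriv_mem ha _) (partialDeriv_mem hb _),
      partialDeriv_add (partialDeriv_mem ha _) (partialDeriv_mem hb _), iha, ihb]
  | mul a b ha hb iha ihb =>
    have key : ∀ v w : V, partialDeriv v (partialDeriv w (a * b)) =
        partialDeriv v (partialDeriv w a) * b + partialDeriv w a * partialDeriv v b +
          (partialDeriv v a * partialDeriv w b + a * partialDeriv v (partialDeriv w b)) := by
      intro v w
      have ha' := partialDeriv_mem ha w
      have hb' := partialDeriv_mem hb w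
      rw [partialDeriv_mul ha hb, partialDeriv_add (mul_mem ha' hb) (mul_mem ha hb'),
        partialDeriv_mul ha' hb, partialDeriv_mul ha hb']
    rw [key, key, iha, ihb]
    ring

/-- The chain rule for a polynomial function along a curve. -/
theorem hasDerivAt_comp_curve {p : V → ℂ} (hp : p ∈ polynomialFunctions V) {γ : ℂ → V} {v : V}
    {t : ℂ} (hγ : ∀ l : Dual ℂ V, HasDerivAt (fun s => l (γ s)) (l v) t) :
    HasDerivAt (fun s => p (γ s)) (differential p (γ t) v) t := by
  induction hp using Algebra.adjoin_induction with
  | mem u hu =>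
    obtain ⟨l, rfl⟩ := hu
    rw [differential_linear]
    exact hγ l
  | algebraMap c =>
    rw [differential_algebraMap]
    exact hasDerivAt_const t c
  | add a b ha hb iha ihb =>
    rw [differential_add ha hb]
    exact iha.add ihb
  | mul a b ha hb iha ihb =>
    rw [differential_mul ha hb]
    exact iha.mul ihb

theorem partialDeriv_smul_of_homogeneous {p : V → ℂ} (hp : p ∈ polynomialFunctions V) {m : ℕ}
    (hom : ∀ (c : ℂ) (x : V), p (c • x) = c ^ (m + 1) * p x) (v : V) {c : ℂ} (hc : c ≠ 0) (x : V) :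
    partialDeriv v p (c • x) = c ^ m * partialDeriv v p x := by
  have h1 : HasDerivAt (fun t : ℂ => p (c • x + t • (c • v)))
      (c ^ (m + 1) * differential p x v) 0 := by
    refine ((hasDerivAt_differential hp x v).const_mul (c ^ (m + 1))).congr_of_eventuallyEq
      (.of_forall fun t => ?_)
    simp only [← hom, smul_add, smul_comm c t v]
  have h2 := differential_apply_eq hp h1
  rw [map_smul, smul_eq_mul, pow_succ', mul_assoc] at h2
  exact mul_left_cancel₀ hc h2

/-- Euler's identity for the partial derivatives of a homogeneous polynomial function. -/
theorem differential_partialDeriv_self_of_homogeneous {p : V → ℂ}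
    (hp : p ∈ polynomialFunctions V) {m : ℕ}
    (hom : ∀ (c : ℂ) (x : V), p (c • x) = c ^ (m + 1) * p x) (v x : V) :
    differential (partialDeriv v p) x x = m * partialDeriv v p x := by
  refine differential_apply_eq (partialDeriv_mem hp v) ?_
  have h1 : HasDerivAt (fun t : ℂ => (1 + t) ^ m * partialDeriv v p x)
      (m * partialDeriv v p x) 0 := by
    have := ((((hasDerivAt_id (0 : ℂ)).const_add 1).pow m).mul_const (partialDeriv v p x))
    simpa using this
  refine h1.congr_of_eventuallyEq ?_
  -- Homogeneity of the partial derivative came from cancelling the scalar, here `1 + t`.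
  have hne : ∀ᶠ t : ℂ in 𝓝 0, 1 + t ≠ 0 :=
    (by fun_prop : ContinuousAt (fun t : ℂ => 1 + t) 0).eventually_ne (by simp)
  filter_upwards [hne] with t ht
  rw [← partialDeriv_smul_of_homogeneous hp hom v ht, add_smul, one_smul]

/-- The differential of a homogeneous polynomial function of degree one is constant. -/
theorem partialDeriv_eq_zero_of_homogeneous_one {p : V → ℂ} (hp : p ∈ polynomialFunctions V)
    (hom : ∀ (c : ℂ) (x : V), p (c • x) = c ^ (0 + 1) * p x) (v x : V) :
    partialDeriv v p x = partialDeriv v p 0 := by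
  -- The partial derivative is constant along `t • x` for `t ≠ 0`; continuity at `t = 0` identifies
  -- that constant with its value at the origin.
  have hc := (hasDerivAt_differential (partialDeriv_mem hp v) 0 x).continuousAt.tendsto
  simp only [zero_add, zero_smul] at hc
  have hc' := hc.mono_left (nhdsWithin_le_nhds (s := {0}ᶜ))
  refine tendsto_nhds_unique (Filter.Tendsto.congr' ?_ tendsto_const_nhds) hc'
  filter_upwards [self_mem_nhdsWithin] with t ht
  simpa using (partialDeriv_smul_of_homogeneous hp hom v ht x).symm

theorem hasDerivAt_endExp (φ : V →ₗ[ℂ] V) (x : V) (l : Dual ℂ V) :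
    HasDerivAt (fun t : ℂ => l (endExp (t • φ) x)) (l (φ x)) 0 := by
  -- An auxiliary choice: the matrix exponential does not depend on the norm.
  let _ : NormedRing (Matrix (Fin (finrank ℂ V)) (Fin (finrank ℂ V)) ℂ) :=
    Matrix.linftyOpNormedRing
  let _ : NormedAlgebra ℂ (Matrix (Fin (finrank ℂ V)) (Fin (finrank ℂ V)) ℂ) :=
    Matrix.linftyOpNormedAlgebra
  let b := finBasis ℂ V
  let L : Matrix (Fin (finrank ℂ V)) (Fin (finrank ℂ V)) ℂ →ₗ[ℂ] ℂ :=
    l ∘ₗ LinearMap.applyₗ x ∘ₗ (Matrix.toLin b b).toLinearMap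
  have h1 := hasDerivAt_exp_smul_const (𝕂 := ℂ) (LinearMap.toMatrix b b φ) (0 : ℂ)
  have h2 := (LinearMap.toContinuousLinearMap L).hasFDerivAt.comp_hasDerivAt (0 : ℂ) h1
  rw [zero_smul, NormedSpace.exp_zero, one_mul] at h2
  have h3 : L (LinearMap.toMatrix b b φ) = l (φ x) := by simp [L]
  rw [← h3]
  refine HasDerivAt.congr_of_eventuallyEq h2 (.of_forall fun t => ?_)
  simp [L, endExp, b]
  rfl

theorem endExp_zero : endExp (0 : V →ₗ[ℂ] V) = LinearMap.id := by
  simp [endExp]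

theorem exists_linearEquiv_eq_endExp (φ : V →ₗ[ℂ] V) :
    ∃ ψ : V ≃ₗ[ℂ] V, (ψ : V →ₗ[ℂ] V) = endExp φ := by
  have h : IsUnit (endExp φ) := by
    have := (Matrix.isUnit_exp (LinearMap.toMatrix (finBasis ℂ V) (finBasis ℂ V) φ)).map
      (Matrix.toLinAlgEquiv (finBasis ℂ V))
    exact this
  obtain ⟨u, hu⟩ := h
  exact ⟨LinearMap.GeneralLinearGroup.toLinearEquiv u, by rw [← hu]; rfl⟩

end PolynomialCalculus

/-! ### Gradients of invariants with respect to the Killing form. -/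

section Gradient

variable {𝔤 : Type*} [LieRing 𝔤] [LieAlgebra ℂ 𝔤] [FiniteDimensional ℂ 𝔤]

/-- The curve `t ↦ exp(t ad a) x` has velocity `[a, x]` at `0` and stays in the orbit of `x`, where
`p` is constant. -/
theorem differential_lie_self {p : 𝔤 → ℂ} (hp : p ∈ invariants 𝔤) (a x : 𝔤) :
    differential p x ⁅a, x⁆ = 0 := by
  have h1 := hasDerivAt_comp_curve hp.1 (γ := fun t => endExp (t • LieAlgebra.ad ℂ 𝔤 a) x)
    (t := 0) (hasDerivAt_endExp (LieAlgebra.ad ℂ 𝔤 a) x)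
  have h2 : (fun t : ℂ => p (endExp (t • LieAlgebra.ad ℂ 𝔤 a) x)) = fun _ => p x := by
    funext t
    obtain ⟨ψ, hψ⟩ := exists_linearEquiv_eq_endExp (t • LieAlgebra.ad ℂ 𝔤 a)
    rw [← hψ]
    exact hp.2 ψ (Subgroup.subset_closure ⟨t • a, by rw [hψ, map_smul]⟩) x
  rw [h2] at h1
  simpa [endExp_zero] using h1.unique (hasDerivAt_const 0 (p x))

section KillingForm

variable {𝔤 : Type*} [LieRing 𝔤] [LieAlgebra ℂ 𝔤]

theorem killingForm_lie (x y z : 𝔤) :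
    killingForm ℂ 𝔤 ⁅x, y⁆ z = killingForm ℂ 𝔤 x ⁅y, z⁆ :=
  LieModule.traceForm_apply_lie_apply ℂ 𝔤 𝔤 x y z

theorem killingForm_lie' (x y z : 𝔤) :
    killingForm ℂ 𝔤 ⁅x, y⁆ z = killingForm ℂ 𝔤 y ⁅z, x⁆ := by
  rw [← lie_skew, map_neg, LinearMap.neg_apply, killingForm_lie, ← map_neg, lie_skew]

end KillingForm

variable [LieAlgebra.IsKilling ℂ 𝔤]

theorem eq_of_killingForm_eq {x y : 𝔤} (h : ∀ v, killingForm ℂ 𝔤 x v = killingForm ℂ 𝔤 y v) :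
    x = y := by
  have := (LinearMap.BilinForm.toDual (killingForm ℂ 𝔤)
    (LieAlgebra.IsKilling.killingForm_nondegenerate ℂ 𝔤)).injective
  exact this (LinearMap.ext h)

theorem lie_killingGradient_self {p : 𝔤 → ℂ} (hp : p ∈ invariants 𝔤) (x : 𝔤) :
    ⁅x, killingGradient p x⁆ = 0 := by
  rw [← lie_skew, neg_eq_zero]
  refine eq_of_killingForm_eq fun v => ?_
  rw [killingForm_lie, killingForm_killingGradient, ← lie_skew, map_neg,
    differential_lie_self hp]
  simp

theorem hasDerivAt_killingForm_killingGradient {p : 𝔤 → ℂ} (hp : p ∈ polynomialFunctions 𝔤)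
    (x v w : 𝔤) :
    HasDerivAt (fun t : ℂ => killingForm ℂ 𝔤 (killingGradient p (x + t • v)) w)
      (differential (partialDeriv w p) x v) 0 := by
  simp only [killingForm_killingGradient]
  exact hasDerivAt_differential (partialDeriv_mem hp w) x v

/-- Every linear form is represented by the Killing form. -/
theorem exists_killingForm_eq (l : Dual ℂ 𝔤) : ∃ w : 𝔤, ∀ x, l x = killingForm ℂ 𝔤 x w := by
  refine ⟨(LinearMap.BilinForm.toDual (killingForm ℂ 𝔤)
    (LieAlgebra.IsKilling.killingForm_nondegenerate ℂ 𝔤)).symm l, fun x => ?_⟩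
  rw [LieModule.traceForm_comm, LinearMap.BilinForm.apply_toDual_symm_apply]

/-- Through the Killing form, `dP(x)` is the Hessian of `p`, hence a self-adjoint operator. -/
theorem killingForm_dirDeriv_killingGradient {p : 𝔤 → ℂ} (hp : p ∈ polynomialFunctions 𝔤)
    (x v w : 𝔤) :
    killingForm ℂ 𝔤 (dirDeriv (killingGradient p) x v) w =
      differential (partialDeriv w p) x v := by
  -- Since partial derivatives commute, the gradient of the derivative along `v` is the derivative
  -- of the gradient along `v`.
  let u : 𝔤 := killingGradient (partialDeriv v p) x
  have hu : ∀ w, killingForm ℂ 𝔤 u w = differential (partialDeriv w p) x v := fun w => by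
    rw [killingForm_killingGradient]
    exact congrFun (partialDeriv_comm hp w v) x
  have h : dirDeriv (killingGradient p) x v = u := by
    refine dirDeriv_eq fun l => ?_
    obtain ⟨w, hw⟩ := exists_killingForm_eq l
    simp only [hw, hu]
    exact hasDerivAt_killingForm_killingGradient hp x v w
  rw [h, hu]

/-- The gradient of an invariant polynomial function is infinitesimally equivariant. -/
theorem dirDeriv_killingGradient_lie {p : 𝔤 → ℂ} (hp : p ∈ invariants 𝔤) (a x : 𝔤) :
    dirDeriv (killingGradient p) x ⁅a, x⁆ = ⁅a, killingGradient p x⁆ := by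
  refine eq_of_killingForm_eq fun v => ?_
  -- This is `dp(x + tv)[a, x + tv] = 0`; its `t`-derivative at `0` pairs the Hessian at `(v, [a,
  -- x])` with `dp(x)[a, v]`.
  have hcurve : ∀ t : ℂ, differential p (x + t • v) ⁅a, x⁆ +
      t * differential p (x + t • v) ⁅a, v⁆ = 0 := fun t => by
    rw [← smul_eq_mul, ← map_smul, ← map_add, ← lie_smul, ← lie_add, differential_lie_self hp]
  have h1 := hasDerivAt_differential (partialDeriv_mem hp.1 ⁅a, x⁆) x v
  have h2 := (hasDerivAt_id (0 : ℂ)).mul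
    (hasDerivAt_differential (partialDeriv_mem hp.1 ⁅a, v⁆) x v)
  have h3 := h1.add h2
  have h4 := h3.unique ((hasDerivAt_const (0 : ℂ) (0 : ℂ)).congr_of_eventuallyEq
    (.of_forall hcurve))
  simp only [one_mul, zero_smul, add_zero, id_eq, zero_mul, partialDeriv] at h4
  have h5 : differential (partialDeriv v p) x ⁅a, x⁆ = differential (partialDeriv ⁅a, x⁆ p) x v :=
    congrFun (partialDeriv_comm hp.1 ⁅a, x⁆ v) x
  rw [killingForm_dirDeriv_killingGradient hp.1, h5, killingForm_lie', ← lie_skew v a, map_neg,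
    killingForm_killingGradient]
  exact eq_neg_of_add_eq_zero_left h4

/-- The derivative of the identity `[x, P x] = 0` satisfied by the gradient `P` of an invariant. -/
theorem lie_dirDeriv_killingGradient {p : 𝔤 → ℂ} (hp : p ∈ invariants 𝔤) (x v : 𝔤) :
    ⁅x, dirDeriv (killingGradient p) x v⁆ = -⁅v, killingGradient p x⁆ := by
  refine eq_of_killingForm_eq fun w => ?_
  -- Invariance of the form reduces both sides to the Hessian at `v` and `[w, x]`, taken in the two
  -- orders.
  rw [killingForm_lie', lie_skew, killingForm_lie, ← killingForm_lie' w,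
    ← dirDeriv_killingGradient_lie hp, killingForm_dirDeriv_killingGradient hp.1,
    killingForm_dirDeriv_killingGradient hp.1]
  exact congrFun (partialDeriv_comm hp.1 v ⁅w, x⁆) x

theorem dirDeriv_killingGradient_self {p : 𝔤 → ℂ} (hp : p ∈ polynomialFunctions 𝔤) {m : ℕ}
    (hom : ∀ (c : ℂ) (x : 𝔤), p (c • x) = c ^ (m + 1) * p x) (x : 𝔤) :
    dirDeriv (killingGradient p) x x = (m : ℂ) • killingGradient p x := by
  refine eq_of_killingForm_eq fun v => ?_
  rw [killingForm_dirDeriv_killingGradient hp,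
    differential_partialDeriv_self_of_homogeneous hp hom, map_smul, LinearMap.smul_apply,
    killingForm_killingGradient, smul_eq_mul, partialDeriv]

theorem dirDeriv_killingGradient_smul {p : 𝔤 → ℂ} (hp : p ∈ polynomialFunctions 𝔤) (c : ℂ)
    (x v : 𝔤) :
    dirDeriv (killingGradient p) x (c • v) = c • dirDeriv (killingGradient p) x v :=
  eq_of_killingForm_eq fun w => by
    simp [killingForm_dirDeriv_killingGradient hp]

/-- If `[h, e] = 2 e` and `P` is the gradient of a homogeneous invariant of degree `m + 1`, then
`[e, dP(e).h] = -2 m P(e)`. -/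
theorem lie_dirDeriv_killingGradient_of_homogeneous {p : 𝔤 → ℂ} (hp : p ∈ invariants 𝔤) {m : ℕ}
    (hom : ∀ (c : ℂ) (x : 𝔤), p (c • x) = c ^ (m + 1) * p x) {h e : 𝔤}
    (hhe : ⁅h, e⁆ = (2 : ℂ) • e) :
    ⁅e, dirDeriv (killingGradient p) e h⁆ = (-2 * (m : ℂ)) • killingGradient p e := by
  rw [lie_dirDeriv_killingGradient hp, ← dirDeriv_killingGradient_lie hp, hhe,
    dirDeriv_killingGradient_smul hp.1, dirDeriv_killingGradient_self hp.1 hom, smul_smul,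
    ← neg_smul, neg_mul]

/-- The gradient is constant in degree one, and it commutes with the point where it is taken, so it
is central; the centre is zero. -/
theorem killingGradient_eq_zero_of_homogeneous_one {p : 𝔤 → ℂ} (hp : p ∈ invariants 𝔤)
    (hom : ∀ (c : ℂ) (x : 𝔤), p (c • x) = c ^ (0 + 1) * p x) (x : 𝔤) :
    killingGradient p x = 0 := by
  have hconst : ∀ y, killingGradient p y = killingGradient p x := fun y =>
    eq_of_killingForm_eq fun v => by
      rw [killingForm_killingGradient, killingForm_killingGradient]
      exact (partialDeriv_eq_zero_of_homogeneous_one hp.1 hom v y).trans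
        (partialDeriv_eq_zero_of_homogeneous_one hp.1 hom v x).symm
  have hmem : killingGradient p x ∈ LieAlgebra.center ℂ 𝔤 := by
    rw [LieModule.mem_maxTrivSubmodule]
    intro y
    rw [← hconst y]
    exact lie_killingGradient_self hp y
  rwa [LieAlgebra.center_eq_bot, LieSubmodule.mem_bot] at hmem

end Gradient

/-! ### The normalizer of a centralizer. -/

section Normalizer

variable {𝔤 : Type*} [LieRing 𝔤] [LieAlgebra ℂ 𝔤]

theorem mem_centralizer {e x : 𝔤} : x ∈ centralizer e ↔ ⁅e, x⁆ = 0 := Iff.rfl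

theorem mem_centralizerCenter {e x : 𝔤} :
    x ∈ centralizerCenter e ↔ ⁅e, x⁆ = 0 ∧ ∀ w : 𝔤, ⁅e, w⁆ = 0 → ⁅w, x⁆ = 0 := by
  constructor
  · rintro ⟨u, hu, rfl⟩
    refine ⟨u.2, fun w hw => ?_⟩
    exact congrArg Subtype.val ((LieModule.mem_maxTrivSubmodule ℂ _ _ u).1 hu ⟨w, hw⟩)
  · rintro ⟨hx, h⟩
    refine ⟨⟨x, hx⟩, ?_, rfl⟩
    exact (LieModule.mem_maxTrivSubmodule ℂ _ _ _).2 fun w => Subtype.ext (h w.1 w.2)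

/-- For `w` in `z`, Jacobi gives `[e, [w, x]] = [w, [e, x]]`; the case `w = e` puts `[e, x]` itself
in `z`. -/
theorem mem_normalizer_centralizer {e x : 𝔤} :
    x ∈ (centralizer e).normalizer ↔ ⁅e, x⁆ ∈ centralizerCenter e := by
  simp only [LieSubalgebra.mem_normalizer_iff', mem_centralizerCenter, mem_centralizer]
  constructor
  · intro hx
    refine ⟨hx e (lie_self e), fun w hw => ?_⟩
    rw [leibniz_lie, ← lie_skew w e, hw, neg_zero, zero_lie, zero_add, hx w hw]
  · rintro ⟨-, hx⟩ w hw
    rw [leibniz_lie, hw, zero_lie, zero_add, hx w hw]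

/-- If the `[e, y i]` form a basis of the centre of the centralizer of `e`, then the `y i` span a
complement of this centralizer in its normalizer. -/
theorem normalizer_eq_of_lie_basis {ι : Type*} {e : 𝔤} {y : ι → 𝔤}
    (hind : LinearIndependent ℂ fun i => ⁅e, y i⁆)
    (hspan : Submodule.span ℂ (Set.range fun i => ⁅e, y i⁆) = centralizerCenter e) :
    ((centralizer e).normalizer.toSubmodule =
        (centralizer e).toSubmodule ⊔ Submodule.span ℂ (Set.range y) ∧
      Disjoint (centralizer e).toSubmodule (Submodule.span ℂ (Set.range y)) ∧
      LinearIndependent ℂ y) ∧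
    Set.BijOn (fun x => ⁅e, x⁆) (Submodule.span ℂ (Set.range y) : Set 𝔤)
      (centralizerCenter e : Set 𝔤) := by
  have hker : (centralizer e).toSubmodule = LinearMap.ker (LieAlgebra.ad ℂ 𝔤 e) := by
    ext x
    rfl
  have hmap : (Submodule.span ℂ (Set.range y)).map (LieAlgebra.ad ℂ 𝔤 e : 𝔤 →ₗ[ℂ] 𝔤) =
      centralizerCenter e := by
    rw [Submodule.map_span, ← Set.range_comp]
    exact hspan
  have hind' : LinearIndependent ℂ ((LieAlgebra.ad ℂ 𝔤 e : 𝔤 →ₗ[ℂ] 𝔤) ∘ y) := hind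
  have hdisj : Disjoint (Submodule.span ℂ (Set.range y))
      (LinearMap.ker (LieAlgebra.ad ℂ 𝔤 e)) :=
    Submodule.range_ker_disjoint hind'
  refine ⟨⟨?_, hker ▸ hdisj.symm, LinearIndependent.of_comp _ hind'⟩, ?_, ?_, ?_⟩
  · have : (centralizer e).normalizer.toSubmodule =
        (centralizerCenter e).comap (LieAlgebra.ad ℂ 𝔤 e : 𝔤 →ₗ[ℂ] 𝔤) := by
      ext x
      exact mem_normalizer_centralizer
    -- The preimage of the image of a subspace is its sum with the kernel.
    rw [this, ← hmap, Submodule.comap_map_eq, hker, sup_comm]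
  · intro x hx
    rw [← hmap]
    exact Submodule.mem_map_of_mem hx
  · exact LinearMap.injOn_of_disjoint_ker le_rfl hdisj
  · intro x hx
    rw [← hmap] at hx
    exact hx

end Normalizer

end NilpotentNormalizer

theorem mainTheorem1 {𝔤 : Type*} [LieRing 𝔤] [LieAlgebra ℂ 𝔤] [FiniteDimensional ℂ 𝔤]
    [LieAlgebra.IsSimple ℂ 𝔤]
    {r : ℕ} (p : Fin r → 𝔤 → ℂ) (m : Fin r → ℕ)
    (hp : NilpotentNormalizer.IsBasicInvariants 𝔤 p m)
    (h e f : 𝔤) (he : IsNilpotent (LieAlgebra.ad ℂ 𝔤 e))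
    (hhe : ⁅h, e⁆ = (2 : ℂ) • e) (hhf : ⁅h, f⁆ = (-2 : ℂ) • f) (hef : ⁅e, f⁆ = h)
    (hδ : NilpotentNormalizer.centralizerCenter e =
      Submodule.span ℂ (Set.range fun j => NilpotentNormalizer.killingGradient (p j) e))
    {s : ℕ} (idx : Fin s → Fin r) (Q : Fin s → 𝔤 → 𝔤)
    (hQ : ∀ i, Q i = NilpotentNormalizer.killingGradient (p (idx i)))
    (hQ_indep : LinearIndependent ℂ fun i => Q i e)
    (hQ_span : Submodule.span ℂ (Set.range fun i => Q i e) =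
      NilpotentNormalizer.centralizerCenter e)
    (y : Fin s → 𝔤) (hy : ∀ i, y i = NilpotentNormalizer.dirDeriv (Q i) e h) :
    -- the normalizer is the direct sum of `z` and of the lines `ℂ y_j`
    ((NilpotentNormalizer.centralizer e).normalizer.toSubmodule =
        (NilpotentNormalizer.centralizer e).toSubmodule ⊔ Submodule.span ℂ (Set.range y) ∧
      Disjoint (NilpotentNormalizer.centralizer e).toSubmodule
        (Submodule.span ℂ (Set.range y)) ∧
      LinearIndependent ℂ y) ∧
    (∀ i, ⁅e, y i⁆ = (-2 * (m (idx i) : ℂ)) • Q i e) ∧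
    Set.BijOn (fun x => ⁅e, x⁆) (Submodule.span ℂ (Set.range y) : Set 𝔤)
      (NilpotentNormalizer.centralizerCenter e : Set 𝔤) := by
  have hinv : ∀ j, p j ∈ NilpotentNormalizer.invariants 𝔤 := fun j => by
    rw [← hp.adjoin_eq]
    exact Algebra.subset_adjoin ⟨j, rfl⟩
  have hlie : ∀ i, ⁅e, y i⁆ = (-2 * (m (idx i) : ℂ)) • Q i e := fun i => by
    rw [hy, hQ]
    exact NilpotentNormalizer.lie_dirDeriv_killingGradient_of_homogeneous (hinv _)
      (hp.homogeneous _) hhe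
  have hm : ∀ i, -2 * (m (idx i) : ℂ) ≠ 0 := fun i => by
    -- If `m'_i = 0`, then `Q_i(e) = 0`, which linear independence forbids.
    refine mul_ne_zero (by norm_num) (Nat.cast_ne_zero.2 fun h0 => hQ_indep.ne_zero i ?_)
    have hom := hp.homogeneous (idx i)
    rw [h0] at hom
    simp only [hQ]
    exact NilpotentNormalizer.killingGradient_eq_zero_of_homogeneous_one (hinv _) hom e
  have hind : LinearIndependent ℂ fun i => ⁅e, y i⁆ := by
    simp only [hlie]
    exact hQ_indep.units_smul fun i => Units.mk0 _ (hm i)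
  have hspan : Submodule.span ℂ (Set.range fun i => ⁅e, y i⁆) =
      NilpotentNormalizer.centralizerCenter e := by
    rw [← hQ_span]
    simp only [hlie]
    refine le_antisymm (Submodule.span_le.2 ?_) (Submodule.span_le.2 ?_)
    · rintro _ ⟨i, rfl⟩
      exact Submodule.smul_mem _ _ (Submodule.subset_span ⟨i, rfl⟩)
    · rintro _ ⟨i, rfl⟩
      exact (Submodule.smul_mem_iff _ (hm i)).1 (Submodule.subset_span ⟨i, rfl⟩)
  obtain ⟨h1, h2⟩ := NilpotentNormalizer.normalizer_eq_of_lie_basis hind hspan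
  exact ⟨h1, hlie, h2⟩
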